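/- Let $q$ be an odd prime power and $\mathbb F_q\subset\mathbb F_{q^3}\subset\mathbb F_{q^6}$. A (finite) presemifield is a finite nonzero additive group with a two-sided distributive multiplication without zero divisors; two presemifields $(\mathbb S,+,\cdot)$ and $(\mathbb S',+,\circ)$ are isotopic if there are additive bijections $g_1,g_2,g_3:\mathbb S\to\mathbb S'$ with $g_1(x\cdot y)=g_2(x)\circ g_3(y)$ for all $x,y\in\mathbb S$. For $r\in\{1,2\}$, a nonsquare $\xi\in\mathbb F_q$ and $a\in\mathbb F_{q^3}^*$ with $N_{q^3/q}(a)\neq 1$, put $A_{a,r}(x)=x^{q^r}-a\,x^{q^{-r}}$ (where $x^{q^{-r}}=x^{q^{3-r}}$), and let $\mathcal D_A=\mathcal D_A(\xi,a,r)$ be $\mathbb F_{q^3}\times\mathbb F_{q^3}$ with componentwise addition and the multiplication $$(u,v)\star_A(x,y)=(u,v)\begin{pmatrix}x&y\\ A_{a,r}(y)&\xi A_{a,r}(x)\end{pmatrix}.$$ Let $\sigma\in\mathbb F_q^*$, $u\in\mathbb F_{q^3}\setminus\mathbb F_q$ and $b\in\mathbb F_{q^6}$ satisfy $u^3=\sigma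 u+1$ and $b^{q^3+1}=\sigma^2+9u+3\sigma u^2$, and consider on $\mathbb F_{q^6}$ the multiplication $$x\star y=(\alpha+\beta u+\gamma u^2)x+\gamma b\,x^{q^3},\qquad y=\alpha+\beta u+\gamma(b+u^2),\quad \alpha,\beta,\gamma\in\mathbb F_{q^2}.\tag{1}$$ **Theorem.** Such $\sigma,u,b$ exist for every odd $q$. For every such choice, each $y\in\mathbb F_{q^6}$ determines $\alpha,\beta,\gamma\in\mathbb F_{q^2}$ in (1) uniquely, and $(\mathbb F_{q^6},+,\star)$ is a presemifield (the presemifield of Ebert, Marino, Polverino and Trombetti). If $N_{q^3/q}(a)=-1$, then, for all admissible $\xi$ and $r$, $\mathcal D_A(\xi,a,r)$ is a presemifield and is isotopic to $(\mathbb F_{q^6},+,\star)$. Consequently, for each $q$, any two presemifields $\mathcal D_A(\xi,a,r)$, $\mathcal D_A(\xi',a',r')$ with $N_{q^3/q}(a)=N_{q^3/q}(a')=-1$ are isotopic. -/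

import Mathlib

/-- A finite presemifield: a finite, nonzero additive group with a multiplication that is
distributive on both sides and has no zero divisors. -/
structure IsPresemifield {S : Type*} [AddCommGroup S] (mul : S → S → S) : Prop where
  finite : Finite S
  nontrivial : Nontrivial S
  left_distrib : ∀ x y z : S, mul x (y + z) = mul x y + mul x z
  right_distrib : ∀ x y z : S, mul (x + y) z = mul x z + mul y z
  no_zero_div : ∀ x y : S, mul x y = 0 → x = 0 ∨ y = 0

/-- Isotopy: three additive bijections (for presemifields of characteristic `p` these are exactly
the invertible `𝔽_p`-linear maps) with `g₁ (x · y) = g₂ x ∘ g₃ y`. -/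
def Isotopic {S S' : Type*} [AddCommGroup S] [AddCommGroup S']
    (mul : S → S → S) (mul' : S' → S' → S') : Prop :=
  ∃ g₁ g₂ g₃ : S ≃+ S', ∀ x y : S, g₁ (mul x y) = mul' (g₂ x) (g₃ y)

/-- The map `A_{a,r}(x) = x^{q^r} - a x^{q^{-r}}` on `𝔽_{q³}`, for `r ∈ {1, 2}`. Since `x^{q³} = x`,
the exponent `q^{-r}` (inverse of the automorphism `x ↦ x^{q^r}`) is `q^{3-r}`. -/
def dempwolffMap {K : Type*} [Field K] (q r : ℕ) (a x : K) : K :=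
  x ^ q ^ r - a * x ^ q ^ (3 - r)

/-- The element `x^{q^{3-r}}` is indeed the `q^r`-th root of `x` in a field of order `q³`. -/
theorem pow_three_sub_pow {K : Type*} [Field K] (q r : ℕ) (hr : r = 1 ∨ r = 2)
    (hK : Nat.card K = q ^ 3) (hq : q ≠ 0) (x : K) : (x ^ q ^ (3 - r)) ^ q ^ r = x := by
  have hfin : Finite K := Nat.finite_of_card_ne_zero (by rw [hK]; positivity)
  have := Fintype.ofFinite K
  have hx : x ^ q ^ 3 = x := by
    rw [← hK, Nat.card_eq_fintype_card]
    exact FiniteField.pow_card x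
  rw [← pow_mul, ← pow_add]
  rcases hr with rfl | rfl <;> exact hx

/-- Admissible parameters of a Dempwolff presemifield of type `𝒟_A` and order `q⁶`
(`F = 𝔽_q`, `K = 𝔽_{q³}`). -/
structure IsDempwolffParam {F K : Type*} [Field F] [Field K] [Algebra F K]
    (ξ : F) (a : K) (r : ℕ) : Prop where
  nonsquare : ¬ IsSquare ξ
  ne_zero : a ≠ 0
  norm_ne_one : Algebra.norm F a ≠ 1
  r_mem : r = 1 ∨ r = 2

/-- The multiplication of `𝒟_A` on `K × K`: `(u, v) ⋆ (x, y)` is the row vector `(u, v)` times the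
matrix with rows `(x, y)` and `(A_{a,r}(y), ξ A_{a,r}(x))`. -/
def dempwolffMul {F K : Type*} [Field F] [Field K] [Algebra F K]
    (q : ℕ) (ξ : F) (a : K) (r : ℕ) (s t : K × K) : K × K :=
  (s.1 * t.1 + s.2 * dempwolffMap q r a t.2,
   s.1 * t.2 + s.2 * (algebraMap F K ξ * dempwolffMap q r a t.1))

/-- Admissible parameters of the Ebert–Marino–Polverino–Trombetti presemifield
(`F = 𝔽_q`, `K = 𝔽_{q³}`, `L = 𝔽_{q⁶}`). -/
structure IsEMPTParam {F K L : Type*} [Field F] [Field K] [Field L] [Algebra F K] [Algebra K L]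
    (q : ℕ) (σ : F) (u : K) (b : L) : Prop where
  sigma_ne_zero : σ ≠ 0
  u_notMem : u ∉ Set.range (algebraMap F K)
  u_cube : u ^ 3 = algebraMap F K σ * u + 1
  b_norm : b ^ (q ^ 3 + 1) = algebraMap K L
    (algebraMap F K σ ^ 2 + 9 * u + 3 * algebraMap F K σ * u ^ 2)

/-- `(α, β, γ)` are coordinates of `y`: they lie in the subfield `𝔽_{q²} = {z | z^{q²} = z}` of
`L = 𝔽_{q⁶}`, and `y = α + β u + γ (b + u²)`. -/
structure IsEMPTCoord {K L : Type*} [Field K] [Field L] [Algebra K L]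
    (q : ℕ) (u : K) (b y : L) (c : L × L × L) : Prop where
  mem₁ : c.1 ^ q ^ 2 = c.1
  mem₂ : c.2.1 ^ q ^ 2 = c.2.1
  mem₃ : c.2.2 ^ q ^ 2 = c.2.2
  eq : y = c.1 + c.2.1 * algebraMap K L u + c.2.2 * (b + algebraMap K L u ^ 2)

open Classical in
/-- The multiplication `x ⋆ y = (α + β u + γ u²) x + γ b x^{q³}` on `L = 𝔽_{q⁶}`, where
`(α, β, γ)` are the coordinates of `y`. (That every `y` has exactly one triple of coordinates is
part of what is claimed, so the default value `0` is never meant to be used.) -/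
noncomputable def emptMul {K L : Type*} [Field K] [Field L] [Algebra K L]
    (q : ℕ) (u : K) (b : L) (x y : L) : L :=
  if h : ∃ c : L × L × L, IsEMPTCoord q u b y c then
    (h.choose.1 + h.choose.2.1 * algebraMap K L u + h.choose.2.2 * algebraMap K L u ^ 2) * x
      + h.choose.2.2 * b * x ^ q ^ 3
  else 0

/-!
On `L = 𝔽_{q⁶}` let `c x = x^{q³}`, `t x = x^{q²}`, and let `Tr` be the trace to `E = 𝔽_{q²}`, the
fixed field of `t`. Both families of presemifields are isotopic to the parameter-free multiplication
`X ∘ Z = X Z - (X - X^c)/2 · Tr(Z)` (`canonMul`).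

* `∘` has no zero divisors: a nontrivial zero product forces `Tr(ρ) = 1` for `ρ = X^c / X`, which has
  norm one to `K = 𝔽_{q³}`, and `traceSum_ne_one` excludes this.
* Let `w² = ξ`, so that `w^c = -w` and `w ∈ E`, and identify `K × K` with `L` by
  `(s, t) ↦ s w + t`. The `E`-linear extension of `A_{a,r}` to `L` is `Y ↦ Y^τ - a Y^{τ⁻¹}` with
  `τ ∈ Gal(L/E)`. If `N(a) = -1`, adding a suitable scalar map makes it a map `Y ↦ d Tr(e Y)` of
  rank one, by Hilbert 90, and the substitution `Z = e Y` absorbs `a` and `r`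
  (`isotopic_dempwolffMul_canonMul`).
* Let `f = X³ - σ X - 1` be the minimal polynomial of `u`. The condition on `b` reads
  `b^{q³+1} = f'(u)²` (`conjDeriv_sq`), that is, `ρ = -b / f'(u)` has norm one to `K`. By Euler's
  formulas for the traces of `uⁱ / f'(u)`, the third coordinate of `y` is
  `γ = Tr(y / f'(u)) / (1 - Tr ρ)`, where again `Tr ρ ≠ 1`; hence `x ⋆ y = x y - γ b (x - x^c)`.
  Writing `ρ = l^c / l` turns this into `∘` (`isotopic_canonMul_of_formula`).

Parameters `σ`, `u`, `b` exist because `x ↦ (x³ - 1) / x` takes at most `q - 1` values, so some cubic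
`X³ - σ X - 1` has no root in `𝔽_q`, and because norms of finite fields are surjective.
-/

/-! ### Isotopy -/

theorem Isotopic.symm {S S' : Type*} [AddCommGroup S] [AddCommGroup S'] {mul : S → S → S}
    {mul' : S' → S' → S'} (h : Isotopic mul mul') : Isotopic mul' mul := by
  obtain ⟨g₁, g₂, g₃, h⟩ := h
  exact ⟨g₁.symm, g₂.symm, g₃.symm, fun x y => by simp [AddEquiv.symm_apply_eq, h]⟩

theorem Isotopic.trans {S S' S'' : Type*} [AddCommGroup S] [AddCommGroup S'] [AddCommGroup S'']
    {mul : S → S → S} {mul' : S' → S' → S'} {mul'' : S'' → S'' → S''}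
    (h : Isotopic mul mul') (h' : Isotopic mul' mul'') : Isotopic mul mul'' := by
  obtain ⟨g₁, g₂, g₃, h⟩ := h
  obtain ⟨k₁, k₂, k₃, h'⟩ := h'
  exact ⟨g₁.trans k₁, g₂.trans k₂, g₃.trans k₃, fun x y => by simp [h, h']⟩

theorem IsPresemifield.of_isotopic {S S' : Type*} [AddCommGroup S] [AddCommGroup S']
    {mul : S → S → S} {mul' : S' → S' → S'} (hS : IsPresemifield mul) (h : Isotopic mul' mul) :
    IsPresemifield mul' := by
  obtain ⟨g₁, g₂, g₃, h⟩ := h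
  have := hS.finite
  have := hS.nontrivial
  refine ⟨Finite.of_equiv S g₁.symm.toEquiv, g₁.toEquiv.nontrivial, fun x y z => ?_,
    fun x y z => ?_, fun x y hxy => ?_⟩
  · apply g₁.injective
    rw [map_add, h, h, h, map_add, hS.left_distrib]
  · apply g₁.injective
    rw [map_add, h, h, h, map_add, hS.right_distrib]
  · have := hS.no_zero_div (g₂ x) (g₃ y) (by rw [← h, hxy, map_zero])
    simpa using this

/-! ### The canonical multiplication -/

/-- The sum `x + x^t + x^{t²}`; for `t` of order three it is the relative trace to the fixed
field of `t`. -/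
def traceSum {L : Type*} [Field L] (t : L →+* L) (x : L) : L := x + t x + t (t x)

theorem traceSum_add {L : Type*} [Field L] (t : L →+* L) (x y : L) :
    traceSum t (x + y) = traceSum t x + traceSum t y := by
  simp only [traceSum, map_add]; ring

theorem traceSum_mul_of_fixed {L : Type*} [Field L] (t : L →+* L) {z : L} (hz : t z = z) (x : L) :
    traceSum t (z * x) = z * traceSum t x := by
  simp only [traceSum, map_mul, hz]; ring

theorem map_traceSum {L : Type*} [Field L] {t : L →+* L} (ht : ∀ x, t (t (t x)) = x) (x : L) :
    t (traceSum t x) = traceSum t x := by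
  simp only [traceSum, map_add, ht]; ring

/-- The parameter-free multiplication `X Z - (X - X^c)/2 · Tr(Z)` to which both families of
presemifields are reduced. Here `c` is an involution of `L`, `t` an automorphism of order three
commuting with it, and `Tr` the trace to the fixed field of `t`. -/
def canonMul {L : Type*} [Field L] (c t : L →+* L) (X Z : L) : L :=
  X * Z - (X - c X) / 2 * traceSum t Z

/-- If `ρ` has norm one for the involution and trace one for `t`, then so has its reciprocal, and
the conjugates of `ρ` under `t` are the roots of a cubic `T³ - T² + n T - n = (T - 1) (T² + n)`.
So one of them is `1`, all of them are, and `3 = 1`. -/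
theorem traceSum_ne_one {L : Type*} [Field L] {c t : L →+* L} (h2 : (2 : L) ≠ 0)
    (hct : ∀ x, c (t x) = t (c x)) {ρ : L} (hρ : ρ * c ρ = 1) : traceSum t ρ ≠ 1 := by
  intro h
  unfold traceSum at h
  have h1 : t ρ * c (t ρ) = 1 := by rw [hct, ← map_mul, hρ, map_one]
  have h3 : t (t ρ) * c (t (t ρ)) = 1 := by rw [hct, hct, ← map_mul, ← map_mul, hρ, map_one,
    map_one]
  have hc := congrArg c h
  simp only [map_add, map_one] at hc
  have hprod : (ρ - 1) * (t ρ - 1) * (t (t ρ) - 1) = 0 := by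
    linear_combination (-ρ * t ρ * t (t ρ)) * hc + (t ρ * t (t ρ)) * hρ + (ρ * t (t ρ)) * h1
      + (ρ * t ρ) * h3 + h
  have hone : ρ = 1 := by
    rcases mul_eq_zero.1 hprod with h' | h'
    · rcases mul_eq_zero.1 h' with h' | h'
      · exact sub_eq_zero.1 h'
      · exact t.injective (by rw [sub_eq_zero.1 h', map_one])
    · exact t.injective (t.injective (by rw [sub_eq_zero.1 h', map_one, map_one]))
  rw [hone, map_one, map_one] at h
  exact h2 (by linear_combination h)

theorem isPresemifield_canonMul {L : Type*} [Field L] [Finite L] {c t : L →+* L}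
    (h2 : (2 : L) ≠ 0) (hc : ∀ x, c (c x) = x) (ht : ∀ x, t (t (t x)) = x)
    (hct : ∀ x, c (t x) = t (c x)) : IsPresemifield (canonMul c t) := by
  refine ⟨inferInstance, inferInstance, fun x y z => ?_, fun x y z => ?_, fun X Z h => ?_⟩
  · simp only [canonMul, traceSum_add]; ring
  · simp only [canonMul, map_add]; ring
  · by_contra! hne
    obtain ⟨hX, hZ⟩ := hne
    set T := traceSum t Z with hT
    have htT : t T = T := map_traceSum ht Z
    have hcX : c X ≠ 0 := by simpa using hX
    set ρ := c X / X with hρ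
    have hnorm : ρ * c ρ = 1 := by
      rw [hρ, map_div₀, hc]; field_simp
    have hZρ : Z = T * ((1 - ρ) / 2) := by
      unfold canonMul at h
      rw [← hT] at h
      rw [hρ]
      field_simp
      field_simp at h
      linear_combination h
    have hT0 : T ≠ 0 := by
      intro h0
      rw [h0, zero_mul] at hZρ
      exact hZ hZρ
    refine traceSum_ne_one h2 hct hnorm ?_
    have key : T = T * traceSum t ((1 - ρ) / 2) := by
      rw [← traceSum_mul_of_fixed t htT, ← hZρ]
    have key' : traceSum t ((1 - ρ) / 2) = 1 :=
      mul_left_cancel₀ hT0 (by rw [← key, mul_one])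
    simp only [traceSum, map_div₀, map_sub, map_one, map_ofNat] at key' ⊢
    field_simp at key'
    linear_combination -key'

/-- Hilbert's Theorem 90 for an involution. -/
theorem exists_map_eq_mul {L : Type*} [Field L] {c : L →+* L} (hc : ∀ x, c (c x) = x)
    {w : L} (hw : w ≠ 0) (hcw : c w = -w) {ρ : L} (hρ : ρ * c ρ = 1) :
    ∃ l : L, l ≠ 0 ∧ c l = ρ * l := by
  by_cases h : ρ = -1
  · exact ⟨w, hw, by rw [h, hcw]; ring⟩
  · refine ⟨1 + c ρ, fun h0 => h ?_, ?_⟩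
    · rw [← hc ρ, eq_neg_of_add_eq_zero_right h0, map_neg, map_one]
    · rw [map_add, hc, map_one]
      linear_combination -hρ

/-- Multiplication by a nonzero element of a field, as an additive bijection. -/
def mulLeftAddEquiv {L : Type*} [Field L] (a : L) (ha : a ≠ 0) : L ≃+ L :=
  { Equiv.mulLeft₀ a ha with map_add' := mul_add a }

/-- The multiplication on the right-hand side of `hmul` is the canonical one after the substitutions
`X = l x` and `w = Z - (1 - ρ)/2 · Tr(Z)`. -/
theorem isotopic_canonMul_of_formula {L : Type*} [Field L] [Finite L] {c t : L →+* L}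
    (h2 : (2 : L) ≠ 0) (ht : ∀ x, t (t (t x)) = x) (hct : ∀ x, c (t x) = t (c x))
    {ρ d l : L} (hd : d ≠ 0) (hl : l ≠ 0) (hcl : c l = ρ * l) (hρ : ρ * c ρ = 1)
    {mul : L → L → L}
    (hmul : ∀ x w, mul x (d * w) =
      d * (x * w + ρ * (x - c x) * (traceSum t w / (1 - traceSum t ρ)))) :
    Isotopic (canonMul c t) mul := by
  have hT : traceSum t ρ ≠ 1 := traceSum_ne_one h2 hct hρ
  have hTW : ∀ Z, traceSum t (Z - traceSum t Z * ((1 - ρ) / 2)) =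
      traceSum t Z * ((traceSum t ρ - 1) / 2) := by
    intro Z
    have h1 := traceSum_add t (Z - traceSum t Z * ((1 - ρ) / 2)) (traceSum t Z * ((1 - ρ) / 2))
    rw [sub_add_cancel, traceSum_mul_of_fixed t (map_traceSum ht Z)] at h1
    have h3 : traceSum t ((1 - ρ) / 2) = (3 - traceSum t ρ) / 2 := by
      simp only [traceSum, map_div₀, map_sub, map_one, map_ofNat]; ring
    rw [h3] at h1
    have h4 : (2 : L) / 2 = 1 := div_self h2
    linear_combination -h1 - traceSum t Z * h4
  let W : L →+ L :=
    { toFun := fun Z => Z - traceSum t Z * ((1 - ρ) / 2)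
      map_zero' := by simp [traceSum]
      map_add' := fun x y => by simp only [traceSum_add]; ring }
  have hW : Function.Injective W := by
    refine (injective_iff_map_eq_zero W).2 fun Z hZ => ?_
    have hZ' : Z - traceSum t Z * ((1 - ρ) / 2) = 0 := hZ
    have h1 := hTW Z
    rw [hZ'] at h1
    have h0 : traceSum t Z = 0 := by
      have h5 : traceSum t Z * ((traceSum t ρ - 1) / 2) = 0 := by
        rw [← h1]; simp [traceSum]
      exact (mul_eq_zero.1 h5).resolve_right (div_ne_zero (sub_ne_zero.2 hT) h2)
    rwa [h0, zero_mul, sub_zero] at hZ'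
  refine ⟨mulLeftAddEquiv (d * l⁻¹) (mul_ne_zero hd (inv_ne_zero hl)),
    mulLeftAddEquiv l⁻¹ (inv_ne_zero hl),
    (AddEquiv.ofBijective W (Finite.injective_iff_bijective.1 hW)).trans
      (mulLeftAddEquiv d hd), fun X Z => ?_⟩
  change d * l⁻¹ * canonMul c t X Z = mul (l⁻¹ * X) (d * (Z - traceSum t Z * ((1 - ρ) / 2)))
  have hcl' : c l ≠ 0 := by simpa using hl
  have hρ0 : ρ ≠ 0 := left_ne_zero_of_mul_eq_one hρ
  have hT' : 1 - traceSum t ρ ≠ 0 := sub_ne_zero.2 hT.symm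
  rw [hmul, hTW, canonMul, map_mul, map_inv₀, hcl]
  field_simp
  ring

/-! ### Coordinates and the multiplication of Ebert, Marino, Polverino and Trombetti -/

/-- The derivative at `u` of the cubic with roots `u`, `u^t`, `u^{t²}`. -/
def conjDeriv {L : Type*} [Field L] (t : L →+* L) (u : L) : L := (u - t u) * (u - t (t u))

theorem conj_ne {L : Type*} [Field L] {t : L →+* L} (ht : ∀ x, t (t (t x)) = x) {u : L}
    (hu : t u ≠ u) : u - t u ≠ 0 ∧ u - t (t u) ≠ 0 ∧ t u - t (t u) ≠ 0 := by
  refine ⟨sub_ne_zero.2 hu.symm, sub_ne_zero.2 fun h => hu ?_, sub_ne_zero.2 fun h => hu ?_⟩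
  · have := congrArg t h
    rwa [ht] at this
  · exact (t.injective h).symm

/-- The trace picks out the leading coefficient of a quadratic polynomial in `u` divided by
`f'(u)`, where `f` is the minimal polynomial of `u` over the fixed field of `t` (Euler). -/
theorem traceSum_div_conjDeriv {L : Type*} [Field L] {t : L →+* L} (ht : ∀ x, t (t (t x)) = x)
    {u α β γ : L} (hu : t u ≠ u) (hα : t α = α) (hβ : t β = β) (hγ : t γ = γ) :
    traceSum t ((α + β * u + γ * u ^ 2) / conjDeriv t u) = γ := by
  obtain ⟨h1, h2, h3⟩ := conj_ne ht hu
  have h1' := sub_ne_zero.2 (sub_ne_zero.1 h1).symm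
  have h2' := sub_ne_zero.2 (sub_ne_zero.1 h2).symm
  have h3' := sub_ne_zero.2 (sub_ne_zero.1 h3).symm
  simp only [traceSum, conjDeriv, map_div₀, map_mul, map_sub, map_add, map_pow, ht, hα, hβ, hγ]
  have e1 : t u - u = -(u - t u) := by ring
  have e2 : t (t u) - u = -(u - t (t u)) := by ring
  have e3 : t (t u) - t u = -(t u - t (t u)) := by ring
  rw [e1, e2, e3]
  field_simp
  ring

theorem traceSum_coord {L : Type*} [Field L] {t : L →+* L} (ht : ∀ x, t (t (t x)) = x)
    {u b α β γ : L} (hu : t u ≠ u) (hα : t α = α) (hβ : t β = β) (hγ : t γ = γ) :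
    traceSum t ((α + β * u + γ * (b + u ^ 2)) / conjDeriv t u) =
      γ * (1 + traceSum t (b / conjDeriv t u)) := by
  have : (α + β * u + γ * (b + u ^ 2)) / conjDeriv t u =
      (α + β * u + γ * u ^ 2) / conjDeriv t u + γ * (b / conjDeriv t u) := by ring
  rw [this, traceSum_add, traceSum_div_conjDeriv ht hu hα hβ hγ, traceSum_mul_of_fixed t hγ]
  ring

/-- An element orthogonal to `1 / f'(u)` for the trace form is a combination `α + β u` with
coefficients fixed by `t`. -/
theorem exists_eq_add_mul_of_traceSum_eq_zero {L : Type*} [Field L] {t : L →+* L}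
    (ht : ∀ x, t (t (t x)) = x) {u y : L} (hu : t u ≠ u)
    (hy : traceSum t (y / conjDeriv t u) = 0) :
    ∃ α β : L, t α = α ∧ t β = β ∧ y = α + β * u := by
  obtain ⟨h1, h2, h3⟩ := conj_ne ht hu
  have e1 : t u - u = -(u - t u) := by ring
  have e2 : t (t u) - u = -(u - t (t u)) := by ring
  have e3 : t (t u) - t u = -(t u - t (t u)) := by ring
  simp only [traceSum, conjDeriv, map_div₀, map_mul, map_sub, ht] at hy
  rw [e1, e2, e3] at hy
  have hβ : t ((y - t y) / (u - t u)) = (y - t y) / (u - t u) := by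
    simp only [map_div₀, map_sub]
    field_simp
    field_simp at hy
    linear_combination -hy
  refine ⟨y - (y - t y) / (u - t u) * u, (y - t y) / (u - t u), ?_, hβ, by ring⟩
  rw [map_sub, map_mul, hβ]
  field_simp
  ring

/-- Two triples of coordinates agree in the third one because `traceSum_coord` computes it, and in
the other two because `u` is not fixed by `t`. -/
theorem existsUnique_isEMPTCoord {K L : Type*} [Field K] [Field L] [Algebra K L] {q : ℕ}
    {t : L →+* L} (htq : ∀ x, t x = x ^ q ^ 2) (ht : ∀ x, t (t (t x)) = x) {u : K} {b : L}
    (hu : t (algebraMap K L u) ≠ algebraMap K L u)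
    (hT : 1 + traceSum t (b / conjDeriv t (algebraMap K L u)) ≠ 0) (y : L) :
    ∃! z : L × L × L, IsEMPTCoord q u b y z := by
  set v := algebraMap K L u with hv
  set s := 1 + traceSum t (b / conjDeriv t v) with hs
  have hts : t s = s := by rw [hs, map_add, map_one, map_traceSum ht]
  apply existsUnique_of_exists_of_unique
  · set γ := traceSum t (y / conjDeriv t v) / s with hγ
    have htγ : t γ = γ := by rw [hγ, map_div₀, map_traceSum ht, hts]
    obtain ⟨α, β, hα, hβ, h⟩ := exists_eq_add_mul_of_traceSum_eq_zero (y := y - γ * (b + v ^ 2))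
      ht hu <| by
        have h1 := traceSum_add t ((y - γ * (b + v ^ 2)) / conjDeriv t v)
          (γ * (b + v ^ 2) / conjDeriv t v)
        have h2 := traceSum_coord (b := b) ht hu (map_zero t) (map_zero t) htγ
        rw [zero_mul, zero_add, zero_add, ← hs] at h2
        rw [h2, ← add_div, sub_add_cancel, hγ, div_mul_cancel₀ _ hT] at h1
        linear_combination -h1
    refine ⟨(α, β, γ), ?_, ?_, ?_, ?_⟩
    · simp only [← htq, hα]
    · simp only [← htq, hβ]
    · simp only [← htq, htγ]
    · simp only [← hv]
      linear_combination h
  · rintro ⟨α, β, γ⟩ ⟨α', β', γ'⟩ ⟨h1, h2, h3, h4⟩ ⟨h1', h2', h3', h4'⟩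
    simp only [← htq, ← hv] at h1 h2 h3 h4 h1' h2' h3' h4'
    have hγ : γ = γ' := by
      have e := traceSum_coord (b := b) ht hu h1 h2 h3
      have e' := traceSum_coord (b := b) ht hu h1' h2' h3'
      rw [← h4, ← hs] at e
      rw [← h4', ← hs] at e'
      exact mul_right_cancel₀ hT (e.symm.trans e')
    subst hγ
    have hlin : α + β * v = α' + β' * v := by linear_combination h4' - h4
    have hlin' := congrArg t hlin
    rw [map_add, map_add, map_mul, map_mul, h1, h2, h1', h2'] at hlin'
    have hβ : β = β' := by
      have : (β - β') * (v - t v) = 0 := by linear_combination hlin - hlin'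
      exact sub_eq_zero.1 ((mul_eq_zero.1 this).resolve_right (conj_ne ht hu).1)
    subst hβ
    rw [add_right_cancel hlin]

theorem emptMul_eq {K L : Type*} [Field K] [Field L] [Algebra K L] {q : ℕ}
    {c t : L →+* L} (hcq : ∀ x, c x = x ^ q ^ 3) (htq : ∀ x, t x = x ^ q ^ 2)
    (ht : ∀ x, t (t (t x)) = x) {u : K} {b : L}
    (hu : t (algebraMap K L u) ≠ algebraMap K L u)
    (hT : 1 + traceSum t (b / conjDeriv t (algebraMap K L u)) ≠ 0) (x y : L) :
    emptMul q u b x y = y * x - b * (x - c x) *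
      (traceSum t (y / conjDeriv t (algebraMap K L u)) /
        (1 + traceSum t (b / conjDeriv t (algebraMap K L u)))) := by
  have hex : ∃ z : L × L × L, IsEMPTCoord q u b y z :=
    (existsUnique_isEMPTCoord htq ht hu hT y).exists
  have hz := hex.choose_spec
  rw [emptMul, dif_pos hex]
  generalize hex.choose = z at hz
  obtain ⟨α, β, γ⟩ := z
  obtain ⟨h1, h2, h3, h4⟩ := hz
  simp only [← htq] at h1 h2 h3
  simp only at h4 ⊢
  have e := traceSum_coord (b := b) ht hu h1 h2 h3
  rw [← h4] at e
  rw [e, mul_div_cancel_right₀ _ hT, ← hcq, h4]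
  ring

/-- With `d = f'(u)` and `ρ = -b/d`, the condition on `b` says that `ρ` has norm one for `c`. -/
theorem existsUnique_coord_and_isotopic_emptMul {K L : Type*} [Field K] [Field L] [Finite L]
    [Algebra K L] {q : ℕ} {c t : L →+* L} (h2 : (2 : L) ≠ 0)
    (hcq : ∀ x, c x = x ^ q ^ 3) (htq : ∀ x, t x = x ^ q ^ 2)
    (hc : ∀ x, c (c x) = x) (ht : ∀ x, t (t (t x)) = x) (hct : ∀ x, c (t x) = t (c x))
    {w : L} (hw : w ≠ 0) (hcw : c w = -w) {u : K} {b : L}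
    (hcu : c (algebraMap K L u) = algebraMap K L u)
    (hu : t (algebraMap K L u) ≠ algebraMap K L u)
    (hb : b * c b = conjDeriv t (algebraMap K L u) ^ 2) :
    (∀ y : L, ∃! z : L × L × L, IsEMPTCoord q u b y z) ∧
      Isotopic (canonMul c t) (emptMul q u b) := by
  set v := algebraMap K L u with hv
  set d := conjDeriv t v with hd
  have hd0 : d ≠ 0 := mul_ne_zero (conj_ne ht hu).1 (conj_ne ht hu).2.1
  have hcd : c d = d := by
    simp only [hd, conjDeriv, map_mul, map_sub, hct, hcu]
  have hρ : (-(b / d)) * c (-(b / d)) = 1 := by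
    rw [map_neg, map_div₀, hcd]
    field_simp
    linear_combination hb
  have hneg : traceSum t (-(b / d)) = -traceSum t (b / d) := by
    simp only [traceSum, map_neg]; ring
  have hT : 1 + traceSum t (b / d) ≠ 0 := by
    intro h0
    refine traceSum_ne_one h2 hct hρ ?_
    rw [hneg]
    linear_combination -h0
  refine ⟨existsUnique_isEMPTCoord htq ht hu hT, ?_⟩
  obtain ⟨l, hl, hcl⟩ := exists_map_eq_mul hc hw hcw hρ
  refine isotopic_canonMul_of_formula h2 ht hct hd0 hl hcl hρ fun x z => ?_
  rw [emptMul_eq hcq htq ht hu hT, ← hv, ← hd, hneg, sub_neg_eq_add, mul_div_cancel_left₀ _ hd0]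
  field_simp
  ring

/-! ### Finite fields -/

open Polynomial in
/-- An irreducible polynomial over a finite field has a root in any finite extension whose degree
is a multiple of its own. -/
theorem exists_aeval_eq_zero_of_natDegree_dvd {F L : Type*} [Field F] [Field L] [Finite L]
    [Algebra F L] {f : F[X]} (hf : Irreducible f) (hdvd : f.natDegree ∣ Module.finrank F L) :
    ∃ x : L, aeval x f = 0 := by
  have : Fact (Irreducible f) := ⟨hf⟩
  have hfin : Module.finrank F (AdjoinRoot f) = f.natDegree :=
    finrank_quotient_span_eq_natDegree (f := f)
  obtain ⟨φ⟩ := FiniteField.nonempty_algHom_of_finrank_dvd (K := AdjoinRoot f) (L := L)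
    (hfin ▸ hdvd)
  exact ⟨φ (AdjoinRoot.root f), by rw [aeval_algHom_apply, AdjoinRoot.aeval_eq, AdjoinRoot.mk_self,
    map_zero]⟩

theorem exists_ringHom_pow {F L : Type*} [Field F] [Finite F] [Field L] (f : F →+* L) (m : ℕ) :
    ∃ φ : L →+* L, ∀ x, φ x = x ^ Nat.card F ^ m := by
  have := Fintype.ofFinite F
  let := f.toAlgebra
  refine ⟨((FiniteField.frobeniusAlgHom F L : L →+* L) ^ m : L →+* L), fun x => ?_⟩
  have : ∀ (n : ℕ) (y : L), ((FiniteField.frobeniusAlgHom F L : L →+* L) ^ n : L →+* L) y =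
      y ^ Nat.card F ^ n := by
    intro n
    induction n with
    | zero => intro y; simp
    | succ n ih =>
      intro y
      rw [pow_succ, RingHom.mul_def, RingHom.comp_apply, ih]
      simp [pow_succ', pow_mul]
  exact this m x

theorem mem_range_algebraMap_of_pow_eq {F K : Type*} [Field F] [Field K] [Finite K] [Algebra F K]
    {x : K} (hx : x ^ Nat.card F = x) : x ∈ Set.range (algebraMap F K) := by
  have := Finite.of_injective _ (algebraMap F K).injective
  obtain ⟨p, hp⟩ := CharP.exists F
  have : Fact p.Prime := ⟨CharP.char_is_prime F p⟩
  refine (IsGalois.mem_range_algebraMap_iff_fixed x).2 fun g => ?_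
  obtain ⟨i, hi⟩ := FiniteField.exists_forall_apply_eq_pow F p K g
  rw [hi]
  clear hi
  induction i with
  | zero => simp
  | succ i ih => rw [pow_succ, pow_mul, ih, hx]

theorem IsCyclic.exists_pow_eq_of_pow_eq_one {G : Type*} [Group G] [IsCyclic G] [Finite G]
    {m n : ℕ} (hn : n ≠ 0) (hG : Nat.card G = m * n) {x : G} (hx : x ^ n = 1) :
    ∃ y : G, y ^ m = x := by
  obtain ⟨g, hg⟩ := IsCyclic.exists_generator (α := G)
  obtain ⟨k, rfl⟩ := Subgroup.mem_zpowers_iff.1 (hg x)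
  rw [← zpow_natCast, ← zpow_mul, ← orderOf_dvd_iff_zpow_eq_one,
    orderOf_eq_card_of_forall_mem_zpowers hg, hG] at hx
  push_cast at hx
  obtain ⟨j, rfl⟩ := Int.dvd_of_mul_dvd_mul_right (by exact_mod_cast hn) hx
  exact ⟨g ^ j, by rw [← zpow_natCast, ← zpow_mul, mul_comm]⟩

/-- Hilbert's Theorem 90 for a cubic extension of finite fields. -/
theorem exists_pow_card_eq_mul {F K : Type*} [Field F] [Field K] [Finite K] [Algebra F K]
    (hK : Module.finrank F K = 3) {x : K} (hx : Algebra.norm F x = 1) :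
    ∃ y : K, y ≠ 0 ∧ y ^ Nat.card F = x * y := by
  have := Finite.of_injective _ (algebraMap F K).injective
  have : Module.Finite F K := Module.finite_of_finrank_pos (by omega)
  have hcard : Nat.card K = Nat.card F ^ 3 := by
    rw [Module.natCard_eq_pow_finrank (K := F), hK]
  have hq : 1 < Nat.card F := Finite.one_lt_card
  have hx0 : x ≠ 0 := by
    rintro rfl
    rw [Algebra.norm_zero] at hx
    exact zero_ne_one hx
  have hnorm := FiniteField.algebraMap_norm_eq_pow_sum F K x
  rw [hx, map_one, hK] at hnorm
  obtain ⟨y, hy⟩ := IsCyclic.exists_pow_eq_of_pow_eq_one (G := Kˣ) (m := Nat.card F - 1)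
    (n := ∑ i ∈ Finset.range 3, Nat.card F ^ i) (x := Units.mk0 x hx0)
    (by simp [Finset.sum_range_succ]) (by
      rw [Nat.card_units, hcard, mul_comm]
      exact (Nat.geomSum_eq hq 3 ▸ Nat.div_mul_cancel (Nat.sub_one_dvd_pow_sub_one _ 3)).symm
      ) (Units.ext (by simpa using hnorm.symm))
  refine ⟨y, y.ne_zero, ?_⟩
  have hy' := congrArg Units.val hy
  rw [Units.val_pow_eq_pow_val, Units.val_mk0] at hy'
  rw [← hy', ← pow_succ, Nat.sub_add_cancel hq.le]

theorem exists_cubic_no_root {F : Type*} [Field F] [Finite F] :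
    ∃ σ : F, ∀ x : F, x ^ 3 ≠ σ * x + 1 := by
  by_contra! h
  choose f hf using h
  have hne : ∀ σ, f σ ≠ 0 := fun σ h0 => by
    have := hf σ
    rw [h0] at this
    simp at this
  have hinj : Function.Injective f := fun σ τ hστ => by
    have h1 := hf σ
    rw [hστ, hf τ] at h1
    exact (mul_right_cancel₀ (hne τ) (add_right_cancel h1)).symm
  obtain ⟨σ, hσ⟩ := Finite.injective_iff_surjective.1 hinj 0
  exact hne σ hσ

open Polynomial in
theorem exists_isEMPTParam {q : ℕ} {F K L : Type*} [Field F] [Field K] [Field L] [Finite L]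
    [Algebra F K] [Algebra K L] (hF : Nat.card F = q) (hK : Module.finrank F K = 3)
    (hL : Module.finrank K L = 2) :
    ∃ (σ : F) (u : K) (b : L), IsEMPTParam q σ u b := by
  have := Finite.of_injective _ (algebraMap K L).injective
  have := Finite.of_injective _ (algebraMap F K).injective
  have : Module.Finite F K := Module.finite_of_finrank_pos (by omega)
  have hcard : Nat.card K = q ^ 3 := by
    rw [Module.natCard_eq_pow_finrank (K := F), hK, hF]
  obtain ⟨σ, hσ⟩ := exists_cubic_no_root (F := F)
  have hdeg : (X ^ 3 - C σ * X - 1 : F[X]).natDegree = 3 := by compute_degree!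
  have hirr : Irreducible (X ^ 3 - C σ * X - 1 : F[X]) := by
    refine irreducible_of_degree_le_three_of_not_isRoot (by rw [hdeg]; decide) fun x hx => hσ x ?_
    simp only [IsRoot.def, eval_sub, eval_pow, eval_X, eval_mul, eval_C, eval_one] at hx
    linear_combination hx
  obtain ⟨u, hu⟩ := exists_aeval_eq_zero_of_natDegree_dvd (L := K) hirr (by rw [hdeg, hK])
  simp only [map_sub, map_mul, map_pow, aeval_X, aeval_C, map_one] at hu
  obtain ⟨b, hb⟩ := FiniteField.norm_surjective K L
    (algebraMap F K σ ^ 2 + 9 * u + 3 * algebraMap F K σ * u ^ 2)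
  refine ⟨σ, u, b, ?_, ?_, by linear_combination hu, ?_⟩
  · rintro rfl
    exact hσ 1 (by ring)
  · rintro ⟨x, rfl⟩
    apply hσ x
    apply (algebraMap F K).injective
    simp only [map_add, map_mul, map_pow, map_one]
    linear_combination hu
  · rw [← hb, FiniteField.algebraMap_norm_eq_pow_sum, hL, hcard]
    simp [Finset.sum_range_succ, add_comm]

theorem two_ne_zero_of_odd_card {F : Type*} [Field F] [Finite F] (h : Odd (Nat.card F)) :
    (2 : F) ≠ 0 := by
  have := Fintype.ofFinite F
  refine Ring.two_ne_zero fun h2 => ?_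
  rw [FiniteField.even_card_iff_char_two, ← Nat.card_eq_fintype_card] at h2
  exact absurd h2 (by rw [Nat.odd_iff.1 h]; decide)

open Polynomial in
/-- A square root in `𝔽_{q⁶}` of a nonsquare of `𝔽_q` lies in `𝔽_{q²}` and is negated by
`x ↦ x^q`. -/
theorem exists_sqrt_of_not_isSquare {F L : Type*} [Field F] [Field L] [Finite L] [Algebra F L]
    (hodd : Odd (Nat.card F)) (hL : 2 ∣ Module.finrank F L) {ξ : F} (hξ : ¬ IsSquare ξ) :
    ∃ w : L, w ≠ 0 ∧ w ^ 2 = algebraMap F L ξ ∧ w ^ Nat.card F = -w := by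
  have := Finite.of_injective _ (algebraMap F L).injective
  have := Fintype.ofFinite F
  have hdeg : (X ^ 2 - C ξ : F[X]).natDegree = 2 := by compute_degree!
  have hirr : Irreducible (X ^ 2 - C ξ : F[X]) := by
    refine irreducible_of_degree_le_three_of_not_isRoot (by rw [hdeg]; decide) fun x hx => hξ ?_
    simp only [IsRoot.def, eval_sub, eval_pow, eval_X, eval_C] at hx
    exact ⟨x, by linear_combination -hx⟩
  obtain ⟨w, hw⟩ := exists_aeval_eq_zero_of_natDegree_dvd (L := L) hirr (by rwa [hdeg])
  simp only [map_sub, map_pow, aeval_X, aeval_C] at hw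
  have hw2 : w ^ 2 = algebraMap F L ξ := sub_eq_zero.1 hw
  have hξ0 : ξ ≠ 0 := by rintro rfl; exact hξ ⟨0, by simp⟩
  have hchar : ringChar F ≠ 2 := fun h => by
    rw [FiniteField.even_card_iff_char_two, ← Nat.card_eq_fintype_card] at h
    exact absurd h (by rw [Nat.odd_iff.1 hodd]; decide)
  have hpow : ξ ^ (Nat.card F / 2) = -1 := by
    rw [Nat.card_eq_fintype_card]
    refine (FiniteField.pow_dichotomy hchar hξ0).resolve_left fun h => hξ ?_
    exact (FiniteField.isSquare_iff hchar hξ0).2 h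
  refine ⟨w, ?_, hw2, ?_⟩
  · rintro rfl
    apply hξ0
    apply (algebraMap F L).injective
    rw [← hw2, map_zero]; ring
  · conv_lhs => rw [← Nat.two_mul_div_two_add_one_of_odd hodd]
    rw [pow_succ, pow_mul, hw2, ← map_pow, hpow, map_neg, map_one]
    ring

/-! ### Dempwolff presemifields with parameter of norm `-1` -/

theorem pow_card_cube {F K : Type*} [Field F] [Field K] [Finite K] [Algebra F K] {q : ℕ}
    (hF : Nat.card F = q) (hK : Module.finrank F K = 3) (x : K) : x ^ q ^ 3 = x := by
  have : Module.Finite F K := Module.finite_of_finrank_pos (by omega)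
  have := Fintype.ofFinite K
  rw [← hF, ← hK, ← Module.natCard_eq_pow_finrank, Nat.card_eq_fintype_card, FiniteField.pow_card]

/-- For such an `e` put `k = e / e^{q^r}`. Then `k Tr(e Y) = e (A_{a,r}(Y) + k Y)`, so that
`A_{a,r}` is a scalar map plus a map of rank one; this is where `N(a) = -1` is used. -/
theorem exists_pow_eq_of_norm_eq_neg_one {F K : Type*} [Field F] [Field K] [Finite K] [Algebra F K]
    {q : ℕ} (hF : Nat.card F = q) (hK : Module.finrank F K = 3) {a : K} {r : ℕ}
    (hr : r = 1 ∨ r = 2) (ha : Algebra.norm F a = -1) :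
    ∃ e : K, e ≠ 0 ∧ e ^ q ^ (3 - r) = -a * e ^ q ^ r := by
  have := Finite.of_injective _ (algebraMap F K).injective
  have hfix : ∀ x : K, x ^ q ^ 3 = x := pow_card_cube hF hK
  have hna : Algebra.norm F (-a) = 1 := by
    have h1 : -a = algebraMap F K (-1) * a := by simp
    rw [h1, map_mul, Algebra.norm_algebraMap, hK, ha]
    ring
  rcases hr with rfl | rfl
  · obtain ⟨y, hy, h⟩ := exists_pow_card_eq_mul hK hna
    rw [hF] at h
    refine ⟨y ^ q ^ 2, pow_ne_zero _ hy, ?_⟩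
    rw [← pow_mul, ← pow_mul, ← pow_add, ← pow_add]
    change y ^ q ^ 4 = -a * y ^ q ^ 3
    rw [pow_succ q 3, pow_mul, hfix, h]
  · have hna' : Algebra.norm F (-a)⁻¹ = 1 := by rw [Algebra.norm_inv, hna, inv_one]
    have ha0 : -a ≠ 0 := fun h0 => by
      rw [h0, inv_zero] at hna'
      rw [h0] at hna
      rw [Algebra.norm_zero] at hna
      exact zero_ne_one hna
    obtain ⟨y, hy, h⟩ := exists_pow_card_eq_mul hK hna'
    rw [hF] at h
    refine ⟨y ^ q ^ 2, pow_ne_zero _ hy, ?_⟩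
    rw [← pow_mul, ← pow_mul, ← pow_add, ← pow_add]
    change y ^ q ^ 3 = -a * y ^ q ^ 4
    rw [pow_succ q 3, pow_mul, hfix, h, mul_inv_cancel_left₀ ha0]

/-- The `K`-basis `w, 1` of `L` identifies `K × K` with `L`. -/
theorem exists_addEquiv_prod {K L : Type*} [Field K] [Field L] [Finite L] [Algebra K L]
    (hL : Module.finrank K L = 2) (h2 : (2 : L) ≠ 0) {c : L →+* L}
    (hcK : ∀ x : K, c (algebraMap K L x) = algebraMap K L x) {w : L} (hw : w ≠ 0)
    (hcw : c w = -w) :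
    ∃ φ : K × K ≃+ L, ∀ z, φ z = algebraMap K L z.1 * w + algebraMap K L z.2 := by
  have := Finite.of_injective _ (algebraMap K L).injective
  have : Module.Finite K L := Module.finite_of_finrank_pos (by omega)
  let f : K × K →+ L :=
    { toFun := fun z => algebraMap K L z.1 * w + algebraMap K L z.2
      map_zero' := by simp
      map_add' := fun x y => by simp only [Prod.fst_add, Prod.snd_add, map_add]; ring }
  have hf : Function.Injective f := by
    refine (injective_iff_map_eq_zero f).2 ?_
    rintro ⟨x, y⟩ h
    have h : algebraMap K L x * w + algebraMap K L y = 0 := h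
    have h' := congrArg c h
    rw [map_add, map_mul, hcK, hcK, hcw, map_zero] at h'
    have hx : 2 * w * algebraMap K L x = 0 := by linear_combination h - h'
    have hy : 2 * algebraMap K L y = 0 := by linear_combination h + h'
    have hx := (mul_eq_zero.1 hx).resolve_left (mul_ne_zero h2 hw)
    have hy := (mul_eq_zero.1 hy).resolve_left h2
    rw [map_eq_zero] at hx hy
    rw [hx, hy]; rfl
  have hcard : Nat.card L ≤ Nat.card (K × K) := by
    rw [Nat.card_prod, Module.natCard_eq_pow_finrank (K := K) (V := L), hL, sq]
  exact ⟨AddEquiv.ofBijective f (hf.bijective_of_nat_card_le hcard), fun z => rfl⟩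

theorem traceSum_algebraMap {F K L : Type*} [Field F] [Field K] [Field L] [Finite K] [Algebra F K]
    [Algebra K L] {q : ℕ} (hF : Nat.card F = q) (hK : Module.finrank F K = 3) {t : L →+* L}
    (htq : ∀ x, t x = x ^ q ^ 2) {r : ℕ} (hr : r = 1 ∨ r = 2) (x : K) :
    traceSum t (algebraMap K L x) = algebraMap K L (x + x ^ q ^ r + x ^ q ^ (3 - r)) := by
  have htt : (x ^ q ^ 2) ^ q ^ 2 = x ^ q := by
    rw [← pow_mul, ← pow_add]
    change x ^ q ^ (3 + 1) = _
    rw [pow_succ, pow_mul, pow_card_cube hF hK]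
  rw [traceSum, htq, htq, ← map_pow, ← map_pow, htt]
  rcases hr with rfl | rfl
  · simp only [map_add, map_pow, Nat.reduceSub, pow_one]; ring
  · simp only [map_add, map_pow, Nat.reduceSub, pow_one]

/-- Write `φ (s, t) = s w + t` with `w² = ξ`. With `e` from `exists_pow_eq_of_norm_eq_neg_one` and
`k = e / e^{q^r}`, the isotopy is `e φ(z ⋆ (x, y)) = (z.1 - k z.2 w) ∘ e (y + x w)`. -/
theorem isotopic_dempwolffMul_canonMul {q : ℕ} {F K L : Type*} [Field F] [Field K] [Field L]
    [Finite L] [Algebra F K] [Algebra K L] (hF : Nat.card F = q) (hK : Module.finrank F K = 3)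
    (hL : Module.finrank K L = 2) (h2 : (2 : L) ≠ 0) {c t : L →+* L}
    (hcK : ∀ x : K, c (algebraMap K L x) = algebraMap K L x)
    (htq : ∀ x, t x = x ^ q ^ 2) {w : L} (hw : w ≠ 0) (hcw : c w = -w) (htw : t w = w) {ξ : F}
    (hξ : w ^ 2 = algebraMap K L (algebraMap F K ξ)) {a : K} {r : ℕ} (hr : r = 1 ∨ r = 2)
    (ha : Algebra.norm F a = -1) :
    Isotopic (dempwolffMul q ξ a r) (canonMul c t) := by
  have := Finite.of_injective _ (algebraMap K L).injective
  obtain ⟨e, he, hea⟩ := exists_pow_eq_of_norm_eq_neg_one hF hK hr ha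
  set k := e / e ^ q ^ r with hk
  have hk0 : k ≠ 0 := div_ne_zero he (pow_ne_zero _ he)
  have hk1 : k * e ^ q ^ r = e := div_mul_cancel₀ _ (pow_ne_zero _ he)
  have hA : ∀ x, k * ((e * x) ^ q ^ r + (e * x) ^ q ^ (3 - r)) = e * dempwolffMap q r a x := by
    intro x
    rw [mul_pow, mul_pow, hea, dempwolffMap]
    linear_combination (x ^ q ^ r - a * x ^ q ^ (3 - r)) * hk1
  have htrace : ∀ x, algebraMap K L k * traceSum t (algebraMap K L (e * x)) =
      algebraMap K L (k * (e * x) + e * dempwolffMap q r a x) := by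
    intro x
    rw [traceSum_algebraMap hF hK htq hr, ← map_mul, ← hA]
    congr 1
    ring
  have he0 : algebraMap K L e ≠ 0 := by simpa using he
  have hk0' : algebraMap K L (-k) ≠ 0 := by simpa using hk0
  obtain ⟨φ, hφ⟩ := exists_addEquiv_prod hL h2 hcK hw hcw
  -- `(s, t) ↦ (t, s)`, then `t ↦ -k t`, gives the coordinates of `s - k t w`.
  refine ⟨φ.trans (mulLeftAddEquiv _ he0),
    (AddEquiv.prodComm.trans ((mulLeftAddEquiv (-k) (neg_ne_zero.2 hk0)).prodCongr
      (AddEquiv.refl K))).trans φ,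
    φ.trans (mulLeftAddEquiv _ he0), ?_⟩
  rintro ⟨s₁, s₂⟩ ⟨x, y⟩
  change algebraMap K L e * φ (dempwolffMul q ξ a r (s₁, s₂) (x, y)) =
    canonMul c t (φ (-k * s₂, s₁)) (algebraMap K L e * φ (x, y))
  have hsplit : algebraMap K L e * (algebraMap K L x * w + algebraMap K L y) =
      w * algebraMap K L (e * x) + algebraMap K L (e * y) := by
    simp only [map_mul]; ring
  have hx := htrace x
  have hy := htrace y
  rw [hφ, hφ, hφ, canonMul, hsplit, traceSum_add, traceSum_mul_of_fixed t htw]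
  simp only [dempwolffMul, map_add, map_mul, map_neg, hcK, hcw] at hx hy ⊢
  field_simp
  linear_combination (-2 * w ^ 2 * algebraMap K L s₂) * hx - 2 * w * algebraMap K L s₂ * hy -
    2 * algebraMap K L e * algebraMap K L s₂ * algebraMap K L (dempwolffMap q r a x) * hξ

/-! ### Combining the reductions -/

/-- For a root `u` of `X³ - s X - 1` the derivative of this cubic at `u` is `3 u² - s`; its square
reduces to the quantity in the condition on `b`. -/
theorem conjDeriv_sq {L : Type*} [Field L] {t : L →+* L} (ht : ∀ x, t (t (t x)) = x) {u s : L}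
    (hu : t u ≠ u) (hs : t s = s) (hcube : u ^ 3 = s * u + 1) :
    conjDeriv t u ^ 2 = s ^ 2 + 9 * u + 3 * s * u ^ 2 := by
  obtain ⟨h1, h2, h3⟩ := conj_ne ht hu
  have hcube₁ : t u ^ 3 = s * t u + 1 := by
    have := congrArg t hcube
    simpa only [map_pow, map_add, map_mul, map_one, hs] using this
  have hcube₂ : t (t u) ^ 3 = s * t (t u) + 1 := by
    have := congrArg t hcube₁
    simpa only [map_pow, map_add, map_mul, map_one, hs] using this
  have e1 : u ^ 2 + u * t u + t u ^ 2 = s :=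
    mul_left_cancel₀ h1 (by linear_combination hcube - hcube₁)
  have e2 : u ^ 2 + u * t (t u) + t (t u) ^ 2 = s :=
    mul_left_cancel₀ h2 (by linear_combination hcube - hcube₂)
  have e3 : u + t u + t (t u) = 0 := mul_left_cancel₀ h3 (by linear_combination e1 - e2)
  have hd : conjDeriv t u = 3 * u ^ 2 - s := by
    have : t (t u) = -u - t u := by linear_combination e3
    rw [conjDeriv, this]
    linear_combination -e1
  rw [hd]
  linear_combination 9 * u * hcube

theorem pow_card_sq_ne_self {F K : Type*} [Field F] [Field K] [Finite K] [Algebra F K] {q : ℕ}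
    (hF : Nat.card F = q) (hK : Module.finrank F K = 3) {u : K}
    (hu : u ∉ Set.range (algebraMap F K)) : u ^ q ^ 2 ≠ u := by
  intro h
  refine hu (mem_range_algebraMap_of_pow_eq ?_)
  rw [hF]
  calc u ^ q = (u ^ q ^ 3) ^ q := by rw [pow_card_cube hF hK]
    _ = (u ^ q ^ 2) ^ q ^ 2 := by rw [← pow_mul, ← pow_mul]; ring_nf
    _ = u := by rw [h, h]

theorem theorem3p1 (q : ℕ) (hq : Odd q)
    {F K L : Type*} [Field F] [Field K] [Field L]
    [Algebra F K] [Algebra K L]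
    (hF : Nat.card F = q) (hK : Module.finrank F K = 3) (hL : Module.finrank K L = 2) :
    -- admissible parameters of the Ebert–Marino–Polverino–Trombetti presemifield exist
    (∃ (σ : F) (u : K) (b : L), IsEMPTParam q σ u b) ∧
    -- for every choice of its parameters it is well defined, and every `𝒟_A` with `N(a) = -1`
    -- is isotopic to it
    (∀ (σ : F) (u : K) (b : L), IsEMPTParam q σ u b →
      (∀ y : L, ∃! c : L × L × L, IsEMPTCoord q u b y c) ∧
      IsPresemifield (emptMul q u b) ∧
      ∀ (ξ : F) (a : K) (r : ℕ), IsDempwolffParam ξ a r → Algebra.norm F a = -1 →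
        IsPresemifield (dempwolffMul q ξ a r) ∧
        Isotopic (dempwolffMul q ξ a r) (emptMul q u b)) ∧
    -- all these `𝒟_A` form a single isotopy class
    (∀ (ξ ξ' : F) (a a' : K) (r r' : ℕ),
      IsDempwolffParam ξ a r → Algebra.norm F a = -1 →
      IsDempwolffParam ξ' a' r' → Algebra.norm F a' = -1 →
      Isotopic (dempwolffMul q ξ a r) (dempwolffMul q ξ' a' r')) := by
  have : Finite F := Nat.finite_of_card_ne_zero (by rw [hF]; rintro rfl; simp at hq)
  have : Module.Finite F K := Module.finite_of_finrank_pos (by omega)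
  have : Module.Finite K L := Module.finite_of_finrank_pos (by omega)
  have : Finite K := Module.finite_of_finite F
  have : Finite L := Module.finite_of_finite K
  have hodd : Odd (Nat.card F) := hF ▸ hq
  let f : F →+* L := (algebraMap K L).comp (algebraMap F K)
  let := f.toAlgebra
  have htower : IsScalarTower F K L := IsScalarTower.of_algebraMap_eq fun _ => rfl
  have hFL : Module.finrank F L = 6 := by rw [← Module.finrank_mul_finrank F K L, hK, hL]
  have h2 : (2 : L) ≠ 0 := by
    rw [← map_ofNat f 2]
    exact (map_ne_zero f).2 (two_ne_zero_of_odd_card hodd)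
  obtain ⟨c, hcq⟩ := exists_ringHom_pow f 3
  obtain ⟨t, htq⟩ := exists_ringHom_pow f 2
  rw [hF] at hcq htq
  have hcardL : ∀ x : L, x ^ q ^ 6 = x := by
    intro x
    have := Fintype.ofFinite L
    rw [← hF, ← hFL, ← Module.natCard_eq_pow_finrank, Nat.card_eq_fintype_card,
      FiniteField.pow_card]
  have hc : ∀ x, c (c x) = x := fun x => by
    rw [hcq, hcq, ← pow_mul, ← pow_add, hcardL]
  have ht : ∀ x, t (t (t x)) = x := fun x => by
    rw [htq, htq, htq, ← pow_mul, ← pow_mul, ← pow_add, ← pow_add, hcardL]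
  have hct : ∀ x, c (t x) = t (c x) := fun x => by rw [htq, htq, map_pow]
  have hcK : ∀ x : K, c (algebraMap K L x) = algebraMap K L x := fun x => by
    rw [hcq, ← map_pow, pow_card_cube hF hK]
  have hFpow : ∀ x : F, x ^ q = x := fun x => by
    have := Fintype.ofFinite F
    rw [← hF, Nat.card_eq_fintype_card, FiniteField.pow_card]
  have htF : ∀ x : F, t (algebraMap K L (algebraMap F K x)) =
      algebraMap K L (algebraMap F K x) := fun x => by
    rw [htq, ← map_pow, ← map_pow, sq, pow_mul, hFpow, hFpow]
  have hsqrt : ∀ ξ : F, ¬ IsSquare ξ → ∃ w : L, w ≠ 0 ∧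
      w ^ 2 = algebraMap K L (algebraMap F K ξ) ∧ c w = -w ∧ t w = w := by
    intro ξ hξ
    obtain ⟨w, hw, hw2, hwq⟩ := exists_sqrt_of_not_isSquare (L := L) hodd (by rw [hFL]; decide) hξ
    rw [hF] at hwq
    have htw : t w = w := by
      rw [htq, sq, pow_mul, hwq, hq.neg_pow, hwq, neg_neg]
    refine ⟨w, hw, hw2, ?_, htw⟩
    rw [hcq, pow_succ, pow_mul, ← htq, htw, hwq]
  have hcanon : IsPresemifield (canonMul c t) := isPresemifield_canonMul h2 hc ht hct
  have hdemp : ∀ (ξ : F) (a : K) (r : ℕ), IsDempwolffParam ξ a r → Algebra.norm F a = -1 →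
      Isotopic (dempwolffMul q ξ a r) (canonMul c t) := by
    intro ξ a r h ha
    obtain ⟨w, hw, hw2, hcw, htw⟩ := hsqrt ξ h.nonsquare
    exact isotopic_dempwolffMul_canonMul hF hK hL h2 hcK htq hw hcw htw hw2 h.r_mem ha
  refine ⟨exists_isEMPTParam hF hK hL, fun σ u b h => ?_, fun ξ ξ' a a' r r' h ha h' ha' =>
    (hdemp ξ a r h ha).trans (hdemp ξ' a' r' h' ha').symm⟩
  have htu : t (algebraMap K L u) ≠ algebraMap K L u := by
    rw [htq, ← map_pow]
    exact fun h0 => pow_card_sq_ne_self hF hK h.u_notMem ((algebraMap K L).injective h0)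
  have hbc : b * c b = conjDeriv t (algebraMap K L u) ^ 2 := by
    rw [conjDeriv_sq ht htu (htF σ) (by rw [← map_pow, h.u_cube]; simp), hcq, ← pow_succ',
      h.b_norm]
    simp only [map_add, map_mul, map_pow, map_ofNat]
  obtain ⟨ξ₀, hξ₀⟩ := FiniteField.exists_nonsquare (F := F) fun hchar =>
    two_ne_zero_of_odd_card hodd (by simpa [hchar] using ringChar.Nat.cast_ringChar (R := F))
  obtain ⟨w, hw, -, hcw, -⟩ := hsqrt ξ₀ hξ₀
  obtain ⟨hcoord, hiso⟩ := existsUnique_coord_and_isotopic_emptMul h2 hcq htq hc ht hct hw hcw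
    (hcK u) htu hbc
  exact ⟨hcoord, hcanon.of_isotopic hiso.symm, fun ξ a r h ha =>
    ⟨hcanon.of_isotopic (hdemp ξ a r h ha), (hdemp ξ a r h ha).trans hiso⟩⟩
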